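/- Let $K$ be an algebraically closed field, let $1\le k\le n$, and let $Q$ be the quiver of type $A_n$ with vertices $1,\dots,n$ and all arrows oriented away from the vertex $k$. Let $\operatorname{mod}KQ$ be the category of finite dimensional right $KQ$-modules, that is, of finite dimensional representations of the opposite quiver $Q^{\mathrm{op}}$ (so that the simple module at $k$ is projective). For $1\le a\le k\le b\le n$ let $M[a,b]$ be the indecomposable module with a one-dimensional space at each vertex $v$ with $a\le v\le b$, zero at the other vertices, and identity maps between adjacent vertices in $[a,b]$. These are the indecomposables whose support contains $k$; they form a rectangle $R$ in the Auslander–Reiten quiver. Arrange them in a $k\times(n-k+1)$ rectangle of boxes in English notation by putting $M[k-r,k+c]$ in the box in row $r$ and column $c$, where $0\le r\le k-1$ and $0\le c\le n-k$; thus the top left box holds the simple projective at $k$, and the lines of morphisms in $R$ that lead to the indecomposable in a given box are its row (coming from the left) and its column (coming from above). Let $\lambda$ be a partition whose diagram, in English notation, is contained in this rectangle. Subcategories are full and additive, i.e. closed under isomorphisms, finite direct sums (including the empty one) and direct summands; a subcategory is quotient-closed if it contains every quotient of each of its objects. A subcategory $\mathcal C$ has a bad $⊑$ inside $\lambda$ if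 there is a box of $\lambda$ whose indecomposable is not in $\mathcal C$, while $\mathcal C$ contains the indecomposable in some box above it in the same column and the indecomposable in some box to the left of it in the same row. The quotient-closed subcategories of $\operatorname{mod}KQ$ that contain every indecomposable outside $\lambda$ (that is, every indecomposable not isomorphic to the one in a box of $\lambda$) are exactly the subcategories that contain every indecomposable outside $\lambda$ and have no bad $⊑$ inside $\lambda$. -/

import Mathlib

open CategoryTheory CategoryTheory.Limits

noncomputable section

namespace TypeA

universe u

/-- The vertices `1, …, n` of the quiver of type `A_n` (the parameter `k` only serves to select the
orientation below). -/
structure Vertex (n k : ℕ) : Type where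
  /-- the label of the vertex -/
  val : ℕ
  one_le : 1 ≤ val
  le_n : val ≤ n

/-- The quiver `Q` of type `A_n` with all arrows oriented away from the vertex `k`: there is exactly
one arrow `i → i + 1` for each `i ≥ k`, exactly one arrow `i → i - 1` for each `i ≤ k`, and there
are no other arrows. -/
instance quiver (n k : ℕ) : Quiver.{0} (Vertex n k) where
  Hom i j := PLift ((k ≤ i.val ∧ j.val = i.val + 1) ∨ (i.val ≤ k ∧ i.val = j.val + 1))

/-- The category `mod KQ` of finite dimensional right modules over the path algebra `KQ`, in the form
of finite dimensional `K`-linear representations of the opposite quiver of `Q`: a vector space `V_i`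
for each vertex `i`, and a linear map `V_j → V_i` (right multiplication by the arrow) for each arrow
`i → j` of `Q`. So the linear maps of a representation all point towards the vertex `k`, and the
simple module at `k` is projective. -/
abbrev ModKQ (K : Type u) [Field K] (n k : ℕ) : Type (u + 1) :=
  Paths (Vertex n k)ᵒᵖ ⥤ FGModuleCat.{u} K

open Classical in
/-- The spaces `PLift p → K` are `K` if `p` holds and `0` otherwise; this is the linear map between
two such spaces that is the identity of `K` if both are `K`, and `0` otherwise. -/
def intervalMap (K : Type u) [Field K] (p q : Prop) : (PLift p → K) →ₗ[K] (PLift q → K) where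
  toFun x := fun _ => if h : p then x ⟨h⟩ else 0
  map_add' x y := by ext; by_cases h : p <;> simp [h]
  map_smul' c x := by ext; by_cases h : p <;> simp [h]

/-- The interval representation `M[a, b]`: it is `K` at the vertices `v` with `a ≤ v ≤ b` and `0` at
the others, and the maps between adjacent vertices of the interval are the identity of `K`. -/
def intervalModule (K : Type u) [Field K] (n k a b : ℕ) : ModKQ K n k :=
  Paths.lift
    { obj := fun v => FGModuleCat.of K (PLift (a ≤ v.unop.val ∧ v.unop.val ≤ b) → K)
      map := fun {v w} _ => FGModuleCat.ofHom
        (intervalMap K (a ≤ v.unop.val ∧ v.unop.val ≤ b) (a ≤ w.unop.val ∧ w.unop.val ≤ b)) }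

/-- The rectangle `R` of the Auslander-Reiten quiver, whose vertices are the indecomposables with `k`
in their support, drawn as a `k × (n - k + 1)` rectangle of boxes in English notation: rows
`r = 0, …, k - 1` from top to bottom, columns `c = 0, …, n - k` from left to right, and
`M[k - r, k + c]` in the box `(r, c)`. The box `(0, 0)` (the left-hand corner of `R` in the
Auslander-Reiten quiver) holds the simple projective at `k`, and the opposite corner holds the
sincere indecomposable `M[1, n]`. The irreducible maps inside `R` are the inclusions of the box
`(r, c)` into the boxes `(r, c + 1)` and `(r + 1, c)`. So the lines of morphisms that lead to the box
`(r, c)` are its row (coming from the boxes `(r, c')` with `c' < c`) and its column (coming from the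
boxes `(r', c)` with `r' < r`). -/
def boxModule (K : Type u) [Field K] (n k : ℕ) (x : ℕ × ℕ) : ModKQ K n k :=
  intervalModule K n k (k - x.1) (k + x.2)

/-- A (full) additive subcategory, given by its class of objects: it is closed under isomorphism,
finite direct sums (including the empty one) and direct summands. -/
structure IsAdditiveSubcategory {K : Type u} [Field K] {n k : ℕ}
    (C : ObjectProperty (ModKQ K n k)) : Prop where
  of_iso : ∀ {M N : ModKQ K n k}, (M ≅ N) → C M → C N
  zero : ∀ M : ModKQ K n k, IsZero M → C M
  biprod_iff : ∀ M N : ModKQ K n k, C (M ⊞ N) ↔ C M ∧ C N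

/-- `C` contains all indecomposables outside the partition `lam`. -/
def ContainsOutside {K : Type u} [Field K] {n k : ℕ} (lam : YoungDiagram)
    (C : ObjectProperty (ModKQ K n k)) : Prop :=
  ∀ M : ModKQ K n k, Indecomposable M → (∀ x ∈ lam, ¬ Nonempty (M ≅ boxModule K n k x)) → C M

/-- `C` has a bad `⊑` inside `lam`: some box `(r, c)` of `lam` holds an indecomposable missing
from `C`, while `C` contains the indecomposable in some box above it in its column and the
indecomposable in some box to the left of it in its row. -/
def HasBadLe {K : Type u} [Field K] {n k : ℕ} (lam : YoungDiagram)
    (C : ObjectProperty (ModKQ K n k)) : Prop :=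
  ∃ r c : ℕ, (r, c) ∈ lam ∧ ¬ C (boxModule K n k (r, c)) ∧
    (∃ r' < r, C (boxModule K n k (r', c))) ∧ (∃ c' < c, C (boxModule K n k (r, c')))

end TypeA

end

/-!
The proof avoids the classification of the indecomposables and works with the linear forms on the
space at the vertex `k`. All structure maps of a representation `V` point towards `k`, so the images
`im (V_v → V_k)` form two filtrations of `V_k`, one for each branch of the quiver.

If `C` is quotient-closed, there is no bad `⊑`: `M[a, b]` is the sum of its submodules `M[a', b]`
and `M[a, b']`, so it is a quotient of their direct sum (`epi_desc_intervalInclusion`).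

Conversely, let `M ∈ C` and let `N` be a quotient of `M`. By induction on the dimension `N` may be
taken indecomposable (`IsAdditiveSubcategory.of_epi`), and by hypothesis only the case `N = M[a, b]`
of a box of `lam` matters. The quotient map gives a linear form `φ` on `M_k` that kills everything
coming from outside `[a, b]` but is nonzero on the image of `M_a`. Take `b' ≥ k` maximal such that
`φ` is nonzero on `im M_a ⊓ im M_{b'}`; then `b' ≤ b`. A vector `x` of this intersection with
`φ x ≠ 0` is not in `im M_{a-1} + im M_{b'+1}`: the first summand lies in `ker φ` and in `im M_a`,
so the second component of `x` would be in `im M_a ⊓ im M_{b'+1}`, where `φ` vanishes by the choice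
of `b'`. Hence `x` and a linear form that separates it from `im M_{a-1} + im M_{b'+1}` exhibit
`M[a, b']` as a retract of `M`, so `C` contains the box of `M[a, b']`, to the left of the given one
in its row or equal to it. Symmetrically `C` contains some `M[a', b]` with `a ≤ a'`, in the column.
As there is no bad `⊑`, `C` contains `M[a, b]` itself.
-/

noncomputable section

namespace TypeA

universe u

variable {n k : ℕ}

/-! ### The path category of the opposite quiver -/

/-- The label of a vertex, regarded as an object of the path category of the opposite quiver. -/
def label (v : Paths (Vertex n k)ᵒᵖ) : ℕ := Vertex.val (Opposite.unop v)

/-- The vertex with label `i`, as an object of the path category of the opposite quiver. -/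
def vertex (i : ℕ) (h₁ : 1 ≤ i) (h₂ : i ≤ n) : Paths (Vertex n k)ᵒᵖ :=
  Opposite.op (⟨i, h₁, h₂⟩ : Vertex n k)

@[simp] lemma label_vertex (i : ℕ) (h₁ : 1 ≤ i) (h₂ : i ≤ n) :
    label (vertex i h₁ h₂ : Paths (Vertex n k)ᵒᵖ) = i := rfl

lemma label_injective : Function.Injective (label : Paths (Vertex n k)ᵒᵖ → ℕ) := by
  rintro ⟨⟨i, _, _⟩⟩ ⟨⟨j, _, _⟩⟩ h
  cases (h : i = j)
  rfl

lemma one_le_label (v : Paths (Vertex n k)ᵒᵖ) : 1 ≤ label v := (Opposite.unop v : Vertex n k).one_le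

lemma label_le (v : Paths (Vertex n k)ᵒᵖ) : label v ≤ n := (Opposite.unop v : Vertex n k).le_n

lemma label_of_arrow {v w : (Vertex n k)ᵒᵖ} (e : v ⟶ w) :
    (label v < k ∧ label w = label v + 1) ∨ (k < label v ∧ label v = label w + 1) := by
  have h := e.unop.down
  change (k ≤ label w ∧ label v = label w + 1) ∨ (label w ≤ k ∧ label w = label v + 1) at h
  omega

/-- The equations `label w = label v` allow for the empty path. -/
lemma label_of_path {v w : (Vertex n k)ᵒᵖ} (p : Quiver.Path v w) :
    (label v ≤ label w ∧ (label w ≤ k ∨ label w = label v)) ∨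
      ((k ≤ label w ∨ label w = label v) ∧ label w ≤ label v) := by
  induction p with
  | nil => simp
  | cons p e ih =>
    have := label_of_arrow e
    omega

/-- Paths lead monotonically towards the vertex `k`. -/
lemma label_of_hom {v w : Paths (Vertex n k)ᵒᵖ} (p : v ⟶ w) :
    (label v ≤ label w ∧ label w ≤ k) ∨ (k ≤ label w ∧ label w ≤ label v) := by
  have := label_of_path p
  omega

/-- The quiver is a tree, so there is at most one path between two vertices. -/
instance subsingleton_hom (v w : Paths (Vertex n k)ᵒᵖ) : Subsingleton (v ⟶ w) := by
  suffices h : ∀ {v w : (Vertex n k)ᵒᵖ} (p q : Quiver.Path v w), p = q from ⟨fun p q => h p q⟩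
  intro v w p
  induction p with
  | nil =>
    intro q
    cases q with
    | nil => rfl
    | cons q e =>
      have := label_of_arrow e
      have := label_of_path q
      omega
  | @cons x w p e ih =>
    intro q
    cases q with
    | nil =>
      have := label_of_arrow e
      have := label_of_path p
      omega
    | @cons y _ q e' =>
      have h₁ := label_of_arrow e
      have h₂ := label_of_path p
      have h₃ := label_of_arrow e'
      have h₄ := label_of_path q
      obtain rfl := label_injective (by omega : label x = label y)
      rw [ih q]
      exact congrArg q.cons (Quiver.Hom.unop_inj (PLift.down_injective (Subsingleton.elim _ _)))

lemma nonempty_hom_of_le {v w : Paths (Vertex n k)ᵒᵖ} (h : label v ≤ label w) (hw : label w ≤ k) :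
    Nonempty (v ⟶ w) := by
  obtain ⟨d, hd⟩ := Nat.exists_eq_add_of_le h
  induction d generalizing v with
  | zero =>
    obtain rfl := label_injective hd
    exact ⟨𝟙 _⟩
  | succ d ih =>
    have hn := label_le w
    obtain ⟨p⟩ := @ih (vertex (label v + 1) (by omega) (by omega)) (by simp; omega)
      (by simp; omega)
    let e : Opposite.unop (vertex (label v + 1) (by omega) (by omega) : Paths (Vertex n k)ᵒᵖ) ⟶
      (Opposite.unop v : Vertex n k) := ⟨Or.inr ⟨(by omega : label v + 1 ≤ k), rfl⟩⟩
    exact ⟨(Paths.of (Vertex n k)ᵒᵖ).map e.op ≫ p⟩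

lemma nonempty_hom_of_ge {v w : Paths (Vertex n k)ᵒᵖ} (h : label w ≤ label v) (hw : k ≤ label w) :
    Nonempty (v ⟶ w) := by
  obtain ⟨d, hd⟩ := Nat.exists_eq_add_of_le h
  induction d generalizing v with
  | zero =>
    obtain rfl := label_injective hd
    exact ⟨𝟙 _⟩
  | succ d ih =>
    have hn := label_le v
    have h₁ := one_le_label w
    obtain ⟨p⟩ := @ih (vertex (label w + d) (by omega) (by omega)) (by simp) (by simp)
    let e : Opposite.unop (vertex (label w + d) (by omega) (by omega) : Paths (Vertex n k)ᵒᵖ) ⟶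
      (Opposite.unop v : Vertex n k) := ⟨Or.inl ⟨(by omega : k ≤ label w + d), hd⟩⟩
    exact ⟨(Paths.of (Vertex n k)ᵒᵖ).map e.op ≫ p⟩

variable {K : Type u} [Field K]

/-! ### Structure maps of interval modules -/

lemma intervalMap_self (K : Type u) [Field K] (p : Prop) : intervalMap K p p = LinearMap.id := by
  refine LinearMap.ext fun x => funext fun ⟨h⟩ => ?_
  simp [intervalMap, h]

lemma intervalMap_comp (K : Type u) [Field K] {p q r : Prop} (h : p → r → q) :
    (intervalMap K q r).comp (intervalMap K p q) = intervalMap K p r := by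
  refine LinearMap.ext fun x => funext fun ⟨hr⟩ => ?_
  by_cases hp : p
  · simp [intervalMap, hp, h hp hr]
  · simp [intervalMap, hp]

/-- On a composite of arrows the interval module acts by the identity of `K` between vertices of
the interval and by `0` otherwise. -/
lemma intervalModule_map (a b : ℕ) (ha : a ≤ k) (hb : k ≤ b) {v w : Paths (Vertex n k)ᵒᵖ}
    (p : v ⟶ w) :
    ((intervalModule K n k a b).map p).hom.hom =
      intervalMap K (a ≤ label v ∧ label v ≤ b) (a ≤ label w ∧ label w ≤ b) := by
  induction p using Paths.induction with
  | id =>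
    rw [CategoryTheory.Functor.map_id]
    exact (intervalMap_self K _).symm
  | @comp u v w p q ih =>
    rw [CategoryTheory.Functor.map_comp, FGModuleCat.hom_hom_comp, ih]
    have : ((intervalModule K n k a b).map ((Paths.of _).map q)).hom.hom =
      intervalMap K (a ≤ label v ∧ label v ≤ b) (a ≤ label w ∧ label w ≤ b) := by
      unfold intervalModule
      erw [Paths.lift_toPath]
      rfl
    rw [this]
    have h₁ := label_of_hom p
    have h₂ := label_of_arrow q
    refine intervalMap_comp K fun hu hw => ?_
    change a ≤ label u ∧ label u ≤ b at hu
    change label u ≤ label v ∧ label v ≤ k ∨ k ≤ label v ∧ label v ≤ label u at h₁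
    omega

lemma intervalModule_map_of_mem {a b : ℕ} (ha : a ≤ k) (hb : k ≤ b)
    {v w : Paths (Vertex n k)ᵒᵖ} (p : v ⟶ w) (hv : a ≤ label v ∧ label v ≤ b)
    (x : PLift (a ≤ label v ∧ label v ≤ b) → K) :
    ((intervalModule K n k a b).map p).hom.hom x =
      (fun _ => x ⟨hv⟩ : PLift (a ≤ label w ∧ label w ≤ b) → K) := by
  rw [intervalModule_map a b ha hb]
  funext h
  exact dif_pos hv

lemma intervalModule_map_of_notMem {a b : ℕ} (ha : a ≤ k) (hb : k ≤ b)
    {v w : Paths (Vertex n k)ᵒᵖ} (p : v ⟶ w) (hv : ¬ (a ≤ label v ∧ label v ≤ b))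
    (x : PLift (a ≤ label v ∧ label v ≤ b) → K) :
    ((intervalModule K n k a b).map p).hom.hom x = 0 := by
  rw [intervalModule_map a b ha hb]
  funext h
  exact dif_neg hv

/-! ### Morphisms from and to interval modules -/

lemma map_map_apply (M : ModKQ K n k) {u v w : Paths (Vertex n k)ᵒᵖ} (p : u ⟶ v) (q : v ⟶ w)
    (r : u ⟶ w) (x : M.obj u) :
    (M.map q).hom.hom ((M.map p).hom.hom x) = (M.map r).hom.hom x := by
  rw [Subsingleton.elim r (p ≫ q), Functor.map_comp]
  rfl

lemma map_self_apply (M : ModKQ K n k) {u : Paths (Vertex n k)ᵒᵖ} (p : u ⟶ u) (x : M.obj u) :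
    (M.map p).hom.hom x = x := by
  rw [Subsingleton.elim p (𝟙 u), CategoryTheory.Functor.map_id]
  rfl

lemma app_map_apply {M N : ModKQ K n k} (f : M ⟶ N) {v w : Paths (Vertex n k)ᵒᵖ} (p : v ⟶ w)
    (x : M.obj v) :
    (f.app w).hom.hom ((M.map p).hom.hom x) = (N.map p).hom.hom ((f.app v).hom.hom x) :=
  LinearMap.congr_fun (congrArg (fun g => g.hom.hom) (f.naturality p)) x

/-- Every vertex has a path to the vertex `k`. -/
lemma nonempty_hom_center {c : Paths (Vertex n k)ᵒᵖ} (hc : label c = k)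
    (v : Paths (Vertex n k)ᵒᵖ) : Nonempty (v ⟶ c) := by
  rcases le_total (label v) k with h | h
  · exact nonempty_hom_of_le (by omega) (by omega)
  · exact nonempty_hom_of_ge (by omega) (by omega)

/-- A linear form `g` on the space at the vertex `k` that kills everything coming from outside
`[a, b]` gives a morphism to the interval module `M[a, b]`; at a vertex of the interval it is `g`
composed with the structure map to the vertex `k`. -/
def toInterval {M : ModKQ K n k} {a b : ℕ} (ha : a ≤ k) (hb : k ≤ b)
    {c : Paths (Vertex n k)ᵒᵖ} (hc : label c = k) (g : M.obj c →ₗ[K] K)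
    (hg : ∀ v (p : v ⟶ c) (y : M.obj v), ¬ (a ≤ label v ∧ label v ≤ b) →
      g ((M.map p).hom.hom y) = 0) :
    M ⟶ intervalModule K n k a b where
  app v := FGModuleCat.ofHom (LinearMap.pi fun _ =>
    g ∘ₗ (M.map (nonempty_hom_center hc v).some).hom.hom :
      M.obj v →ₗ[K] (PLift (a ≤ label v ∧ label v ≤ b) → K))
  naturality v w p := by
    refine FGModuleCat.hom_ext (LinearMap.ext fun x => ?_)
    change _ = ((intervalModule K n k a b).map p).hom.hom (fun _ => g _)
    have h₁ : g ((M.map (nonempty_hom_center hc w).some).hom.hom ((M.map p).hom.hom x)) =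
        g ((M.map (nonempty_hom_center hc v).some).hom.hom x) := by
      rw [map_map_apply M p _ (nonempty_hom_center hc v).some]
    by_cases hv : a ≤ label v ∧ label v ≤ b
    · exact (funext fun _ => h₁).trans (intervalModule_map_of_mem ha hb p hv
        fun _ => g ((M.map (nonempty_hom_center hc v).some).hom.hom x)).symm
    · exact (funext fun _ => h₁.trans (hg _ _ _ hv)).trans
        (intervalModule_map_of_notMem ha hb p hv
        fun _ => g ((M.map (nonempty_hom_center hc v).some).hom.hom x)).symm

lemma toInterval_app {M : ModKQ K n k} {a b : ℕ} (ha : a ≤ k) (hb : k ≤ b)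
    {c : Paths (Vertex n k)ᵒᵖ} (hc : label c = k) (g : M.obj c →ₗ[K] K)
    (hg : ∀ v (p : v ⟶ c) (y : M.obj v), ¬ (a ≤ label v ∧ label v ≤ b) →
      g ((M.map p).hom.hom y) = 0) {v : Paths (Vertex n k)ᵒᵖ} (p : v ⟶ c) (x : M.obj v)
    (h : PLift (a ≤ label v ∧ label v ≤ b)) :
    ((toInterval ha hb hc g hg).app v).hom.hom x h = g ((M.map p).hom.hom x) := by
  rw [Subsingleton.elim p (nonempty_hom_center hc v).some]
  rfl

open Classical in
/-- A family of vectors that is compatible with the structure maps starting in `[a, b]` gives a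
morphism from the interval module `M[a, b]`, which sends the basis vectors to the given ones. -/
def ofInterval {M : ModKQ K n k} {a b : ℕ} (ha : a ≤ k) (hb : k ≤ b)
    (s : ∀ v, M.obj v)
    (hs : ∀ v w (p : v ⟶ w), a ≤ label v ∧ label v ≤ b → (M.map p).hom.hom (s v) = s w) :
    intervalModule K n k a b ⟶ M where
  app v := FGModuleCat.ofHom (if h : a ≤ label v ∧ label v ≤ b then
      LinearMap.toSpanSingleton K (M.obj v) (s v) ∘ₗ LinearMap.proj ⟨h⟩ else 0 :
        (PLift (a ≤ label v ∧ label v ≤ b) → K) →ₗ[K] M.obj v)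
  naturality v w p := by
    refine FGModuleCat.hom_ext (LinearMap.ext
      fun (x : PLift (a ≤ label v ∧ label v ≤ b) → K) => ?_)
    have hp := label_of_hom p
    change (dite (a ≤ label w ∧ label w ≤ b) _ _ :
        (PLift (a ≤ label w ∧ label w ≤ b) → K) →ₗ[K] M.obj w)
          (((intervalModule K n k a b).map p).hom.hom x) =
      (M.map p).hom.hom ((dite (a ≤ label v ∧ label v ≤ b) _ _ :
        (PLift (a ≤ label v ∧ label v ≤ b) → K) →ₗ[K] M.obj v) x)
    by_cases hv : a ≤ label v ∧ label v ≤ b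
    · have hw : a ≤ label w ∧ label w ≤ b := by omega
      rw [dif_pos hv, dif_pos hw, intervalModule_map_of_mem ha hb p hv]
      change x ⟨hv⟩ • s w = (M.map p).hom.hom (x ⟨hv⟩ • s v)
      rw [map_smul, hs v w p hv]
    · rw [dif_neg hv, intervalModule_map_of_notMem ha hb p hv]
      exact (map_zero _).trans (map_zero (M.map p).hom.hom).symm

lemma ofInterval_app {M : ModKQ K n k} {a b : ℕ} (ha : a ≤ k) (hb : k ≤ b)
    (s : ∀ v, M.obj v)
    (hs : ∀ v w (p : v ⟶ w), a ≤ label v ∧ label v ≤ b → (M.map p).hom.hom (s v) = s w)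
    {v : Paths (Vertex n k)ᵒᵖ} (h : a ≤ label v ∧ label v ≤ b)
    (x : PLift (a ≤ label v ∧ label v ≤ b) → K) :
    ((ofInterval ha hb s hs).app v).hom.hom x = x ⟨h⟩ • s v := by
  change (dite (a ≤ label v ∧ label v ≤ b) _ _ :
        (PLift (a ≤ label v ∧ label v ≤ b) → K) →ₗ[K] M.obj v) x = _
  rw [dif_pos h]
  rfl

/-- A vector at the vertex `k` coming both from `a` and from `b` extends to a compatible family on
`[a, b]`. -/
lemma exists_compatible_family (M : ModKQ K n k) {c va vb : Paths (Vertex n k)ᵒᵖ}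
    (hc : label c = k) (ha : label va ≤ k) (pa : va ⟶ c) (pb : vb ⟶ c)
    (ya : M.obj va) (yb : M.obj vb)
    (hab : (M.map pa).hom.hom ya = (M.map pb).hom.hom yb) :
    ∃ s : ∀ v, M.obj v, s c = (M.map pa).hom.hom ya ∧
      ∀ v w (p : v ⟶ w), label va ≤ label v ∧ label v ≤ label vb →
        (M.map p).hom.hom (s v) = s w := by
  classical
  refine ⟨fun v => if h : Nonempty (va ⟶ v) then (M.map h.some).hom.hom ya else
    if h : Nonempty (vb ⟶ v) then (M.map h.some).hom.hom yb else 0, ?_, ?_⟩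
  · have h : Nonempty (va ⟶ c) := ⟨pa⟩
    simp only [h, dite_true]
    rw [Subsingleton.elim h.some pa]
  · intro v w p hv
    have hp := label_of_hom p
    by_cases h : Nonempty (va ⟶ v)
    · have hw : Nonempty (va ⟶ w) := ⟨h.some ≫ p⟩
      simp only [h, hw, dite_true]
      exact map_map_apply M _ _ _ _
    · have hvk : k < label v := by
        by_contra hvk
        exact h (nonempty_hom_of_le hv.1 (by omega))
      have hv' : Nonempty (vb ⟶ v) := nonempty_hom_of_ge hv.2 hvk.le
      simp only [h, hv', dite_true, dite_false]
      by_cases hw : Nonempty (va ⟶ w)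
      · -- the path `p` crosses into the branch of `a`, which is only possible at the vertex `k`
        have hw' := label_of_hom hw.some
        obtain rfl := label_injective (by omega : label w = label c)
        simp only [hw, dite_true]
        rw [Subsingleton.elim hw.some pa, hab]
        exact map_map_apply M _ _ _ _
      · have hw' : Nonempty (vb ⟶ w) := ⟨hv'.some ≫ p⟩
        simp only [hw, hw', dite_true, dite_false]
        exact map_map_apply M _ _ _ _

/-! ### Interval modules as direct summands -/

/-- An additive subcategory contains the retracts of its objects: a split monomorphism of an abelian
category has a complement. -/
lemma IsAdditiveSubcategory.of_retract {C : ObjectProperty (ModKQ K n k)}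
    (hC : IsAdditiveSubcategory C) {M N : ModKQ K n k} (i : N ⟶ M) (r : M ⟶ N)
    (hir : i ≫ r = 𝟙 N) (hM : C M) : C N := by
  have : IsSplitMono i := ⟨⟨⟨r, hir⟩⟩⟩
  have hb := isBilimitBinaryBiconeOfIsSplitMonoOfCokernel (cokernelIsCokernel i)
  exact ((hC.biprod_iff _ _).1 (hC.of_iso (biprod.uniqueUpToIso _ _ hb) hM)).1

/-- If a vector at the vertex `k` comes from both ends of `[a, b]`, and some linear form is nonzero
on it but kills everything that comes from outside `[a, b]`, then `M[a, b]` is a direct summand. -/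
lemma IsAdditiveSubcategory.interval_mem {C : ObjectProperty (ModKQ K n k)}
    (hC : IsAdditiveSubcategory C) {M : ModKQ K n k} (hM : C M)
    {c va vb : Paths (Vertex n k)ᵒᵖ}
    (hc : label c = k) (ha : label va ≤ k) (hb : k ≤ label vb) (pa : va ⟶ c) (pb : vb ⟶ c)
    (ya : M.obj va) (yb : M.obj vb)
    (hab : (M.map pa).hom.hom ya = (M.map pb).hom.hom yb) (g : M.obj c →ₗ[K] K)
    (hg₁ : g ((M.map pa).hom.hom ya) = 1)
    (hg : ∀ v (p : v ⟶ c) (y : M.obj v), ¬ (label va ≤ label v ∧ label v ≤ label vb) →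
      g ((M.map p).hom.hom y) = 0) :
    C (intervalModule K n k (label va) (label vb)) := by
  obtain ⟨s, hsc, hs⟩ := exists_compatible_family M hc ha pa pb ya yb hab
  refine hC.of_retract (ofInterval ha hb s hs) (toInterval ha hb hc g hg) ?_ hM
  refine NatTrans.ext (funext fun v => FGModuleCat.hom_ext (LinearMap.ext
    fun (x : PLift (label va ≤ label v ∧ label v ≤ label vb) → K) => funext
      fun (h : PLift (label va ≤ label v ∧ label v ≤ label vb)) => ?_))
  obtain ⟨p⟩ := nonempty_hom_center hc v
  change ((toInterval ha hb hc g hg).app v).hom.hom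
    (((ofInterval ha hb s hs).app v).hom.hom x) h = x h
  rw [ofInterval_app ha hb s hs h.down, toInterval_app ha hb hc g hg p, map_smul, map_smul,
    hs v c p h.down, hsc, hg₁]
  simp

/-! ### Separating two filtrations -/

/-- Let `L₀ ≤ L₁` be subspaces and `R 0 = V, R 1, …` a sequence of subspaces. If a linear form `φ` is
nonzero on `L₁` but vanishes on `L₀` and on `R (m + 1)`, then for some `j ≤ m` there is a vector in
`L₁ ⊓ R j` outside of `L₀ ⊔ R (j + 1)`; the second condition is expressed by a linear form. -/
lemma exists_linearForm_separating {V : Type*} [AddCommGroup V] [Module K V] (φ : V →ₗ[K] K)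
    {L₀ L₁ : Submodule K V} (hL : L₀ ≤ L₁) (R : ℕ → Submodule K V) {m : ℕ} (hR₀ : R 0 = ⊤)
    (hRm : R (m + 1) ≤ LinearMap.ker φ) (hL₀ : L₀ ≤ LinearMap.ker φ)
    (hL₁ : ¬ L₁ ≤ LinearMap.ker φ) :
    ∃ j ≤ m, ∃ x ∈ L₁, x ∈ R j ∧ ∃ g : V →ₗ[K] K, g x = 1 ∧ L₀ ≤ LinearMap.ker g ∧
      R (j + 1) ≤ LinearMap.ker g := by
  classical
  -- `j` is maximal such that `φ` does not vanish on `L₁ ⊓ R j`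
  have hex : ∃ i, L₁ ⊓ R (i + 1) ≤ LinearMap.ker φ := ⟨m, inf_le_right.trans hRm⟩
  have hpred : ¬ L₁ ⊓ R (Nat.find hex) ≤ LinearMap.ker φ := by
    rcases h : Nat.find hex with _ | i
    · simpa [hR₀] using hL₁
    · exact Nat.find_min hex (by omega)
  have hsucc := Nat.find_spec hex
  refine ⟨Nat.find hex, Nat.find_min' hex (inf_le_right.trans hRm), ?_⟩
  obtain ⟨x, ⟨hx₁, hx₂⟩, hx⟩ := SetLike.not_le_iff_exists.1 hpred
  refine ⟨x, hx₁, hx₂, ?_⟩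
  have hxW : x ∉ L₀ ⊔ R (Nat.find hex + 1) := by
    intro h
    obtain ⟨l, hl, r, hr, rfl⟩ := Submodule.mem_sup.1 h
    have hr' : r ∈ L₁ := by simpa using L₁.sub_mem hx₁ (hL hl)
    exact hx (Submodule.add_mem _ (hL₀ hl) (hsucc ⟨hr', hr⟩))
  obtain ⟨g, hgx, hg⟩ := Submodule.exists_le_ker_of_notMem hxW
  refine ⟨(g x)⁻¹ • g, by simp [hgx], ?_⟩
  rw [← sup_le_iff]
  exact hg.trans fun y hy => by simp_all

/-- The subspace of the space at `c` spanned by everything that comes from vertices whose label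
satisfies `S`. -/
def imageFrom (M : ModKQ K n k) (c : Paths (Vertex n k)ᵒᵖ) (S : ℕ → Prop) :
    Submodule K (M.obj c) :=
  ⨆ (v) (_ : S (label v)) (p : v ⟶ c), LinearMap.range (M.map p).hom.hom

lemma map_mem_imageFrom (M : ModKQ K n k) {v c : Paths (Vertex n k)ᵒᵖ} {S : ℕ → Prop}
    (hv : S (label v)) (p : v ⟶ c) (y : M.obj v) : (M.map p).hom.hom y ∈ imageFrom M c S :=
  Submodule.mem_iSup_of_mem v (Submodule.mem_iSup_of_mem hv
    (Submodule.mem_iSup_of_mem p (LinearMap.mem_range_self _ y)))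

lemma imageFrom_le {M : ModKQ K n k} {c : Paths (Vertex n k)ᵒᵖ} {S : ℕ → Prop}
    {W : Submodule K (M.obj c)}
    (h : ∀ v (p : v ⟶ c) (y : M.obj v), S (label v) → (M.map p).hom.hom y ∈ W) :
    imageFrom M c S ≤ W := by
  refine iSup_le fun v => iSup_le fun hv => iSup_le fun p => ?_
  rintro _ ⟨y, rfl⟩
  exact h v p y hv

lemma imageFrom_mono (M : ModKQ K n k) (c : Paths (Vertex n k)ᵒᵖ) {S T : ℕ → Prop}
    (h : ∀ i, S i → T i) : imageFrom M c S ≤ imageFrom M c T :=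
  imageFrom_le fun _ p y hv => map_mem_imageFrom M (h _ hv) p y

lemma imageFrom_eq_top (M : ModKQ K n k) {c : Paths (Vertex n k)ᵒᵖ} {S : ℕ → Prop}
    (hc : S (label c)) : imageFrom M c S = ⊤ :=
  eq_top_iff.2 fun x _ => by
    rw [← map_self_apply M (𝟙 c) x]
    exact map_mem_imageFrom M hc _ x

/-- If all vertices selected by `S` lie behind `w`, then everything that comes from them comes
from `w`. -/
lemma exists_map_eq_of_mem_imageFrom {M : ModKQ K n k} {w c : Paths (Vertex n k)ᵒᵖ} {S : ℕ → Prop}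
    (hS : ∀ v : Paths (Vertex n k)ᵒᵖ, S (label v) → Nonempty (v ⟶ w)) (q : w ⟶ c)
    {x : M.obj c} (hx : x ∈ imageFrom M c S) : ∃ y, (M.map q).hom.hom y = x := by
  refine imageFrom_le (W := LinearMap.range (M.map q).hom.hom) (fun v p y hv => ?_) hx
  exact ⟨(M.map (hS v hv).some).hom.hom y, map_map_apply M _ q p y⟩

/-! ### Interval summands of a module that maps onto an interval module -/

lemma surjective_app_of_epi {M N : ModKQ K n k} (f : M ⟶ N) [Epi f] (v : Paths (Vertex n k)ᵒᵖ) :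
    Function.Surjective (f.app v).hom.hom := by
  have : Epi ((forget₂ (FGModuleCat K) (ModuleCat K)).map (f.app v)) := inferInstance
  exact (ModuleCat.epi_iff_surjective _).1 this

/-- The linear form on the space at the vertex `k` given by a morphism to an interval module. -/
def ofToInterval {M : ModKQ K n k} {a b : ℕ} (ha : a ≤ k) (hb : k ≤ b)
    {c : Paths (Vertex n k)ᵒᵖ} (hc : label c = k) (f : M ⟶ intervalModule K n k a b) :
    M.obj c →ₗ[K] K :=
  (LinearMap.proj ⟨⟨ha.trans hc.ge, hc.le.trans hb⟩⟩ :
    (PLift (a ≤ label c ∧ label c ≤ b) → K) →ₗ[K] K) ∘ₗ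
    (f.app c).hom.hom

lemma ofToInterval_map_of_notMem {M : ModKQ K n k} {a b : ℕ} (ha : a ≤ k) (hb : k ≤ b)
    {c : Paths (Vertex n k)ᵒᵖ} (hc : label c = k) (f : M ⟶ intervalModule K n k a b)
    {v : Paths (Vertex n k)ᵒᵖ} (p : v ⟶ c) (hv : ¬ (a ≤ label v ∧ label v ≤ b)) (y : M.obj v) :
    ofToInterval ha hb hc f ((M.map p).hom.hom y) = 0 := by
  have h := app_map_apply f p y
  exact congrFun (h.trans (intervalModule_map_of_notMem ha hb p hv _)) _

lemma exists_ofToInterval_map_ne_zero {M : ModKQ K n k} {a b : ℕ} (ha : a ≤ k) (hb : k ≤ b)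
    {c : Paths (Vertex n k)ᵒᵖ} (hc : label c = k) (f : M ⟶ intervalModule K n k a b) [Epi f]
    {v : Paths (Vertex n k)ᵒᵖ} (p : v ⟶ c) (hv : a ≤ label v ∧ label v ≤ b) :
    ∃ y : M.obj v, ofToInterval ha hb hc f ((M.map p).hom.hom y) ≠ 0 := by
  obtain ⟨y, hy⟩ := surjective_app_of_epi f v
    (fun _ => 1 : PLift (a ≤ label v ∧ label v ≤ b) → K)
  refine ⟨y, ?_⟩
  have h := app_map_apply f p y
  rw [hy, intervalModule_map_of_mem ha hb p hv] at h
  exact (congrFun h _).trans_ne one_ne_zero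

/-- If `M[a, b]` is a quotient of an object of `C`, then `C` contains some `M[a, b']` with
`b' ≤ b`. -/
lemma IsAdditiveSubcategory.exists_interval_of_left {C : ObjectProperty (ModKQ K n k)}
    (hC : IsAdditiveSubcategory C) {M : ModKQ K n k} (hM : C M) {a b : ℕ} (ha₁ : 1 ≤ a)
    (ha : a ≤ k) (hb : k ≤ b) (hbn : b ≤ n) (f : M ⟶ intervalModule K n k a b) [Epi f] :
    ∃ b', k ≤ b' ∧ b' ≤ b ∧ C (intervalModule K n k a b') := by
  let c : Paths (Vertex n k)ᵒᵖ := vertex k (by omega) (by omega)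
  have hc : label c = k := rfl
  let va : Paths (Vertex n k)ᵒᵖ := vertex a ha₁ (by omega)
  obtain ⟨pa⟩ := nonempty_hom_center hc va
  obtain ⟨y, hy⟩ := exists_ofToInterval_map_ne_zero ha hb hc f pa ⟨le_refl a, ha.trans hb⟩
  obtain ⟨j, hj, x, hx₁, hx₂, g, hgx, hg₁, hg₂⟩ := exists_linearForm_separating
    (ofToInterval ha hb hc f) (L₀ := imageFrom M c (· < a)) (L₁ := imageFrom M c (· ≤ a))
    (imageFrom_mono M c fun i hi => le_of_lt hi) (fun j => imageFrom M c (k + j ≤ ·)) (m := b - k)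
    (imageFrom_eq_top M hc.ge)
    (imageFrom_le fun v p y hv => ofToInterval_map_of_notMem ha hb hc f p (by omega) y)
    (imageFrom_le fun v p y hv => ofToInterval_map_of_notMem ha hb hc f p (by omega) y)
    (fun h => hy (h (map_mem_imageFrom M (le_refl a) pa y)))
  let vb : Paths (Vertex n k)ᵒᵖ := vertex (k + j) (by omega) (by omega)
  obtain ⟨pb⟩ := nonempty_hom_center hc vb
  obtain ⟨ya, hya⟩ := exists_map_eq_of_mem_imageFrom
    (fun v hv => nonempty_hom_of_le (w := va) hv ha) pa hx₁
  obtain ⟨yb, hyb⟩ := exists_map_eq_of_mem_imageFrom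
    (fun v hv => nonempty_hom_of_ge (w := vb) hv (Nat.le_add_right k j)) pb hx₂
  refine ⟨k + j, by omega, by omega, ?_⟩
  refine hC.interval_mem (va := va) (vb := vb) hM hc ha (Nat.le_add_right k j)
    pa pb ya yb (hya.trans hyb.symm) g (by rw [hya, hgx]) fun v p y hv => ?_
  change ¬ (a ≤ label v ∧ label v ≤ k + j) at hv
  rcases lt_or_ge (label v) a with h | h
  · exact hg₁ (map_mem_imageFrom M h p y)
  · exact hg₂ (map_mem_imageFrom M (by omega : k + (j + 1) ≤ label v) p y)

/-- If `M[a, b]` is a quotient of an object of `C`, then `C` contains some `M[a', b]` with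
`a ≤ a'`. -/
lemma IsAdditiveSubcategory.exists_interval_of_right {C : ObjectProperty (ModKQ K n k)}
    (hC : IsAdditiveSubcategory C) {M : ModKQ K n k} (hM : C M) {a b : ℕ} (ha₁ : 1 ≤ a)
    (ha : a ≤ k) (hb : k ≤ b) (hbn : b ≤ n) (f : M ⟶ intervalModule K n k a b) [Epi f] :
    ∃ a', a ≤ a' ∧ a' ≤ k ∧ C (intervalModule K n k a' b) := by
  let c : Paths (Vertex n k)ᵒᵖ := vertex k (by omega) (by omega)
  have hc : label c = k := rfl
  let vb : Paths (Vertex n k)ᵒᵖ := vertex b (by omega) hbn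
  obtain ⟨pb⟩ := nonempty_hom_center hc vb
  obtain ⟨y, hy⟩ := exists_ofToInterval_map_ne_zero ha hb hc f pb ⟨ha.trans hb, le_refl b⟩
  obtain ⟨j, hj, x, hx₁, hx₂, g, hgx, hg₁, hg₂⟩ := exists_linearForm_separating
    (ofToInterval ha hb hc f) (L₀ := imageFrom M c (b < ·)) (L₁ := imageFrom M c (b ≤ ·))
    (imageFrom_mono M c fun i hi => le_of_lt hi) (fun j => imageFrom M c (· ≤ k - j)) (m := k - a)
    (imageFrom_eq_top M hc.le)
    (imageFrom_le fun v p y hv => ofToInterval_map_of_notMem ha hb hc f p (by omega) y)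
    (imageFrom_le fun v p y hv => ofToInterval_map_of_notMem ha hb hc f p (by omega) y)
    (fun h => hy (h (map_mem_imageFrom M (le_refl b) pb y)))
  let va : Paths (Vertex n k)ᵒᵖ := vertex (k - j) (by omega) (by omega)
  obtain ⟨pa⟩ := nonempty_hom_center hc va
  obtain ⟨yb, hyb⟩ := exists_map_eq_of_mem_imageFrom
    (fun v hv => nonempty_hom_of_ge (w := vb) hv hb) pb hx₁
  obtain ⟨ya, hya⟩ := exists_map_eq_of_mem_imageFrom
    (fun v hv => nonempty_hom_of_le (w := va) hv (Nat.sub_le k j)) pa hx₂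
  refine ⟨k - j, by omega, by omega, ?_⟩
  refine hC.interval_mem (va := va) (vb := vb) hM hc (Nat.sub_le k j) hb
    pa pb ya yb (hya.trans hyb.symm) g (by rw [hya, hgx]) fun v p y hv => ?_
  change ¬ (k - j ≤ label v ∧ label v ≤ b) at hv
  rcases lt_or_ge b (label v) with h | h
  · exact hg₁ (map_mem_imageFrom M h p y)
  · exact hg₂ (map_mem_imageFrom M (by omega : label v ≤ k - (j + 1)) p y)

/-! ### An interval module as a sum of two submodules -/

/-- The inclusion `M[a, b] → M[a', b']` for `a' ≤ a ≤ k ≤ b ≤ b'`. -/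
def intervalInclusion {a b a' b' : ℕ} (haa : a' ≤ a) (ha : a ≤ k) (hb : k ≤ b) (hbb : b ≤ b') :
    intervalModule K n k a b ⟶ intervalModule K n k a' b' :=
  ofInterval ha hb (fun v => (fun _ => 1 : PLift (a' ≤ label v ∧ label v ≤ b') → K))
    fun _ _ p hv => intervalModule_map_of_mem (haa.trans ha) (hb.trans hbb) p
      ⟨haa.trans hv.1, hv.2.trans hbb⟩ _

lemma epi_of_surjective {X Y : FGModuleCat K} (f : X ⟶ Y)
    (hf : Function.Surjective f.hom.hom) : Epi f :=
  ConcreteCategory.epi_of_surjective f hf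

lemma epi_intervalInclusion_app {a b a' b' : ℕ} (haa : a' ≤ a) (ha : a ≤ k) (hb : k ≤ b)
    (hbb : b ≤ b') {v : Paths (Vertex n k)ᵒᵖ}
    (hv : a' ≤ label v ∧ label v ≤ b' → a ≤ label v ∧ label v ≤ b) :
    Epi ((intervalInclusion (K := K) haa ha hb hbb).app v) := by
  refine epi_of_surjective _ fun (y : PLift (a' ≤ label v ∧ label v ≤ b') → K) => ?_
  by_cases h : a ≤ label v ∧ label v ≤ b
  · refine ⟨(fun _ => y ⟨by omega⟩ : PLift (a ≤ label v ∧ label v ≤ b) → K), ?_⟩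
    refine (ofInterval_app ha hb _ _ h _).trans ?_
    funext h'
    exact mul_one _
  · exact ⟨0, funext fun h' => absurd (hv h'.down) h⟩

lemma epi_app_of_comp_eq {X Y Z : ModKQ K n k} {f : X ⟶ Y} {g : Y ⟶ Z} {h : X ⟶ Z}
    (w : f ≫ g = h) (v : Paths (Vertex n k)ᵒᵖ) [Epi (h.app v)] : Epi (g.app v) :=
  epi_of_epi_fac (f := f.app v) (h := h.app v) (by rw [← w, NatTrans.comp_app])

/-- `M[a, b]` is the sum of its submodules `M[a', b]` and `M[a, b']`. -/
lemma epi_desc_intervalInclusion {a b a' b' : ℕ} (ha : a ≤ a') (ha' : a' ≤ k) (hb' : k ≤ b')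
    (hb : b' ≤ b) :
    Epi (biprod.desc
      (intervalInclusion ha ha' (hb'.trans hb) le_rfl :
        intervalModule K n k a' b ⟶ intervalModule K n k a b)
      (intervalInclusion le_rfl (ha.trans ha') hb' hb)) := by
  refine @NatTrans.epi_of_epi_app _ _ _ _ _ _ _ fun v => ?_
  by_cases hv : k ≤ label v
  · have := epi_intervalInclusion_app (K := K) ha ha' (hb'.trans hb) le_rfl (v := v) (by omega)
    exact epi_app_of_comp_eq (biprod.inl_desc _ _) v
  · have := epi_intervalInclusion_app (K := K) le_rfl (ha.trans ha') hb' hb (v := v) (by omega)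
    exact epi_app_of_comp_eq (biprod.inr_desc _ _) v

/-! ### Quotients and indecomposable summands -/

instance : Finite (Paths (Vertex n k)ᵒᵖ) :=
  Finite.of_injective (fun v => (⟨label v, Nat.lt_succ_of_le (label_le v)⟩ : Fin (n + 1)))
    fun _ _ h => label_injective (Fin.mk.inj h)

/-- The total dimension of a representation. The sum is finite, as the quiver has finitely many
vertices. -/
def totalDim (M : ModKQ K n k) : ℕ := ∑ᶠ v, Module.finrank K (M.obj v)

lemma totalDim_eq_of_iso_biprod {M A B : ModKQ K n k} (e : M ≅ A ⊞ B) :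
    totalDim M = totalDim A + totalDim B := by
  unfold totalDim
  rw [← finsum_add_distrib (Set.toFinite _) (Set.toFinite _)]
  refine finsum_congr fun v => ?_
  have h₁ : (biprod.inl ≫ e.inv) ≫ e.hom ≫ biprod.fst = 𝟙 A := by simp
  have h₂ : (biprod.inl ≫ e.inv) ≫ e.hom ≫ biprod.snd = (0 : A ⟶ B) := by simp
  have h₃ : (biprod.inr ≫ e.inv) ≫ e.hom ≫ biprod.fst = (0 : B ⟶ A) := by simp
  have h₄ : (biprod.inr ≫ e.inv) ≫ e.hom ≫ biprod.snd = 𝟙 B := by simp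
  have h₅ : (e.hom ≫ biprod.fst) ≫ biprod.inl ≫ e.inv +
      (e.hom ≫ biprod.snd) ≫ biprod.inr ≫ e.inv = 𝟙 M := by
    simp only [Category.assoc, ← Preadditive.comp_add]
    simp only [← Category.assoc, ← Preadditive.add_comp, biprod.total]
    simp
  have happ : ∀ {X Y : ModKQ K n k} {f g : X ⟶ Y} (_ : f = g) (x : X.obj v),
      (f.app v).hom.hom x = (g.app v).hom.hom x := by
    rintro X Y f _ rfl x
    rfl
  let e' : M.obj v ≃ₗ[K] A.obj v × B.obj v := by
    refine LinearEquiv.ofLinearMap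
      (((e.hom ≫ biprod.fst).app v).hom.hom.prod ((e.hom ≫ biprod.snd).app v).hom.hom)
      (((biprod.inl ≫ e.inv).app v).hom.hom.coprod ((biprod.inr ≫ e.inv).app v).hom.hom)
      (LinearMap.prod_ext (LinearMap.ext fun x => ?_) (LinearMap.ext fun x => ?_))
      (LinearMap.ext fun x => happ h₅ x)
    · rw [LinearMap.comp_assoc, LinearMap.coprod_inl]
      exact Prod.ext (happ h₁ x) (happ h₂ x)
    · rw [LinearMap.comp_assoc, LinearMap.coprod_inr]
      exact Prod.ext (happ h₃ x) (happ h₄ x)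
  rw [e'.finrank_eq, Module.finrank_prod]

lemma isZero_of_totalDim_eq_zero {M : ModKQ K n k} (h : totalDim M = 0) : IsZero M := by
  refine Functor.isZero _ fun v => (IsZero.iff_id_eq_zero _).2 (FGModuleCat.hom_ext ?_)
  have hv : Module.finrank K (M.obj v) ≤ totalDim M :=
    single_le_finsum (f := fun v => Module.finrank K (M.obj v)) v (Set.toFinite _)
      fun _ => Nat.zero_le _
  have : Subsingleton (M.obj v) := (Module.finrank_zero_iff (R := K)).1 (by omega)
  exact LinearMap.ext fun x => Subsingleton.elim _ _

/-- Every quotient of `M` is a finite direct sum of indecomposable quotients of `M`. -/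
lemma IsAdditiveSubcategory.of_epi {C : ObjectProperty (ModKQ K n k)}
    (hC : IsAdditiveSubcategory C) {M : ModKQ K n k}
    (h : ∀ (N : ModKQ K n k) (f : M ⟶ N), Epi f → Indecomposable N → C N)
    (N : ModKQ K n k) (f : M ⟶ N) [Epi f] : C N := by
  induction hd : totalDim N using Nat.strong_induction_on generalizing N with
  | _ d ih =>
    by_cases hN : Indecomposable N
    · exact h N f ‹_› hN
    by_cases hz : IsZero N
    · exact hC.zero N hz
    simp only [Indecomposable, hz, not_false_eq_true, true_and, not_forall, not_or] at hN
    obtain ⟨A, B, e, hA, hB⟩ := hN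
    have hAB := totalDim_eq_of_iso_biprod e
    have hA' := mt isZero_of_totalDim_eq_zero hA
    have hB' := mt isZero_of_totalDim_eq_zero hB
    exact hC.of_iso e.symm ((hC.biprod_iff A B).2
      ⟨ih _ (by omega) A (f ≫ e.hom ≫ biprod.fst) rfl,
        ih _ (by omega) B (f ≫ e.hom ≫ biprod.snd) rfl⟩)

end TypeA
end

/-! ### Quotient-closed subcategories and the rectangle -/

theorem proposition12 (K : Type*) [Field K] [IsAlgClosed K] (n k : ℕ) (hk : 1 ≤ k) (hkn : k ≤ n)
    (lam : YoungDiagram) (hlam : lam.cells ⊆ Finset.range k ×ˢ Finset.range (n - k + 1))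
    (C : CategoryTheory.ObjectProperty (TypeA.ModKQ K n k))
    (hC : TypeA.IsAdditiveSubcategory C) :
    (C.IsClosedUnderQuotients ∧ TypeA.ContainsOutside lam C) ↔
      (¬ TypeA.HasBadLe lam C ∧ TypeA.ContainsOutside lam C) := by
  have hbox : ∀ {r c : ℕ}, (r, c) ∈ lam → r < k ∧ k + c ≤ n := by
    intro r c h
    have h' := hlam ((YoungDiagram.mem_cells _).2 h)
    simp only [Finset.mem_product, Finset.mem_range] at h'
    omega
  refine and_congr_left fun hout => ⟨fun hquot => ?_, fun hbad => ⟨fun {M N} f _ hM => ?_⟩⟩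
  · -- the box `(r, c)` holds a quotient of the direct sum of those in `(r', c)` and `(r, c')`
    rintro ⟨r, c, hrc, hnot, ⟨r', hr', hr'C⟩, ⟨c', hc', hc'C⟩⟩
    obtain ⟨hr, hc⟩ := hbox hrc
    have := TypeA.epi_desc_intervalInclusion (K := K) (n := n) (k := k) (a := k - r)
      (a' := k - r') (b' := k + c') (b := k + c) (by omega) (by omega) (by omega) (by omega)
    exact hnot (@hquot.prop_of_epi _ _ _ this ((hC.biprod_iff _ _).2 ⟨hr'C, hc'C⟩))
  · refine hC.of_epi (M := M) ?_ N f
    intro N f _ hN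
    by_cases hNbox : ∀ x ∈ lam, ¬ Nonempty (N ≅ TypeA.boxModule K n k x)
    · exact hout N hN hNbox
    push Not at hNbox
    obtain ⟨⟨r, c⟩, hrc, ⟨e⟩⟩ := hNbox
    obtain ⟨hr, hc⟩ := hbox hrc
    refine hC.of_iso e.symm ?_
    by_contra hnot
    let f' : M ⟶ TypeA.intervalModule K n k (k - r) (k + c) := f ≫ e.hom
    have : CategoryTheory.Epi f' := CategoryTheory.epi_comp f e.hom
    obtain ⟨b, hkb, hbc, hb⟩ := hC.exists_interval_of_left hM (by omega) (by omega) (by omega)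
      (by omega) f'
    obtain ⟨a, har, hak, ha⟩ := hC.exists_interval_of_right hM (by omega) (by omega) (by omega)
      (by omega) f'
    obtain ⟨c', rfl⟩ := Nat.exists_eq_add_of_le hkb
    obtain ⟨r', hr', rfl⟩ : ∃ r' ≤ r, a = k - r' := ⟨k - a, by omega, by omega⟩
    have hc' : c' < c := lt_of_le_of_ne (by omega) fun h => hnot (h ▸ hb)
    have hr'' : r' < r := lt_of_le_of_ne hr' fun h => hnot (h ▸ ha)
    exact hbad ⟨r, c, hrc, hnot, ⟨r', hr'', ha⟩, ⟨c', hc', hb⟩⟩
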